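/- Let $\Omega\subset\mathbb R^d$ be a domain (open and connected; $d=2,3$ are the cases of interest, but $d$ is arbitrary). For a velocity field $u$ put $\varepsilon(u)=\frac12(\nabla u+\nabla u^{T})$ and $\varepsilon_{II}(u)=(\frac12\,\varepsilon(u):\varepsilon(u))^{1/2}$. Let $\mu_r,\tau_y:\Omega\to(0,\infty)$ be measurable (reference viscosity and yield stress, possibly depending on $x$), let $\underline\mu\ge 0$ be a constant and let $f\in L^2(\Omega)^d$. Consider the nonlinear Stokes problem $$-\nabla\cdot[\mu(u)(\nabla u+\nabla u^T)]+\nabla p=f,\qquad \nabla\cdot u=0\quad\text{in }\Omega,\qquad u=0\ \text{on }\partial\Omega,$$ with the ideal viscosity $\mu_i(u)=\underline\mu+\min\bigl(\tau_y/(2\varepsilon_{II}(u)),\mu_r\bigr)$ (the minimum being $\mu_r$ where $\varepsilon_{II}(u)=0$), or with the composite viscosity $\mu_c(u)=\tau_y\mu_r/(2\varepsilon_{II}(u)\mu_r+\tau_y)$, in which case $\underline\mu=0$ is assumed. Correspondingly let $\varphi=\varphi_i$ or $\varphi=\varphi_c$, where for $\sigma\ge0$ $$\varphi_i(\sigma)=\begin{cases}2\mu_r\sigma^2+\dfrac{\tau_y^2}{2\mu_r}&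 2\mu_r\sigma\le\tau_y,\\ 2\tau_y\sigma&\text{otherwise,}\end{cases}\qquad \varphi_c(\sigma)=2\tau_y\sigma-\frac{\tau_y^2}{\mu_r}\log(\tau_y+2\mu_r\sigma).$$ Assume $\tau_y\in L^2(\Omega)$ and that $\varphi(0)$, as a function of $x$, is integrable over $\Omega$ (both hold, for instance, if $\Omega$ is bounded and $\mu_r,\tau_y$ are constants). Let $H^1_0(\Omega)^d$ be the closure of $C_c^\infty(\Omega)^d$ in $H^1(\Omega)^d$, let $V=\{u\in H^1_0(\Omega)^d:\nabla\cdot u=0\}$, and put $$\Phi(u)=\int_\Omega\varphi(\varepsilon_{II}(u))\,dx+2\underline\mu\int_\Omega\varepsilon_{II}(u)^2\,dx-\int_\Omega f\cdot u\,dx .$$ Call $u\in V$ a velocity solution if $\int_\Omega\mu(u)(\nabla u+\nabla u^T):\nabla v\,dx=\int_\Omega f\cdot v\,dx$ for all $v\in V$, where $\mu=\mu_i$ or $\mu_c$. Then: 1. For constants $\mu_r,\tau_y>0$ both functions $\varphi$ are convex and $C^1$ on $[0,\infty)$, with $\varphi_i'(\sigma)=2\min(2\mu_r\sigma,\tau_y)$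 and $\varphi_c'(\sigma)=4\mu_r\tau_y\sigma/(2\mu_r\sigma+\tau_y)$; and $\varphi'(\sigma)/(2\sigma)+2\underline\mu$ equals twice the corresponding viscosity at $\varepsilon_{II}=\sigma>0$. 2. All integrals above and below converge for $u,v\in H^1_0(\Omega)^d$, and $\Phi$ is convex on $H^1_0(\Omega)^d$. 3. At every $u\in H^1_0(\Omega)^d$ the functional $\Phi$ has a Gateaux derivative $\Phi'(u)$, a bounded linear functional on $H^1_0(\Omega)^d$, and for all $v\in H^1_0(\Omega)^d$ (in particular for all $v \in V$) $$\Phi'(u)v=\int_\Omega\varphi'(\varepsilon_{II}(u))\frac{\varepsilon(u):\varepsilon(v)}{2\varepsilon_{II}(u)}\,dx+\int_\Omega2\underline\mu\,\varepsilon(u):\varepsilon(v)\,dx-\int_\Omega f\cdot v\,dx=\int_\Omega\mu(u)(\nabla u+\nabla u^T):\nabla v\,dx-\int_\Omega f\cdot v\,dx,$$ the first integrand being $0$ where $\varepsilon(u)=0$. 4. For $u\in H^1_0(\Omega)^d$ the following are equivalent: $u$ is a velocity solution; $u$ is a critical point of $\Phi$ over $V$, i.e. $u\in V$ and $\Phi'(u)v=0$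 for all $v\in V$; $u\in V$ and $u$ minimizes $\Phi$ over $V$. 5. If $u\in V$ and $p\in L^2(\Omega)$ satisfy the momentum equation in the sense of distributions on $\Omega$, then $u$ is a velocity solution. -/

import Mathlib

open MeasureTheory TopologicalSpace
open scoped Distributions ContDiff

noncomputable section

namespace Viscoplastic

/-- Euclidean space `ℝ^d`, the space of points and of velocities. -/
abbrev Vec (d : ℕ) := EuclideanSpace ℝ (Fin d)

/-- Jacobians of velocity fields, as linear maps. -/
abbrev Jac (d : ℕ) := Vec d →L[ℝ] Vec d

/-- Pairs (velocity, gradient) in `L²(Ω)^d × L²(Ω)^{d × d}`. -/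
abbrev L2Pair {d : ℕ} (Ω : Opens (Vec d)) :=
  Lp (Vec d) 2 (volume.restrict (Ω : Set (Vec d))) ×
    Lp (Jac d) 2 (volume.restrict (Ω : Set (Vec d)))

/-- The matrix `(∇u)_{ij} = ∂_j u_i` of a Jacobian. -/
def gradMatrix {d : ℕ} (G : Jac d) : Matrix (Fin d) (Fin d) ℝ :=
  Matrix.of fun i j => G (EuclideanSpace.single j 1) i

/-- The inner product `A : B` of second-order tensors. -/
def contraction {d : ℕ} (A B : Matrix (Fin d) (Fin d) ℝ) : ℝ := ∑ i, ∑ j, A i j * B i j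

/-- The strain rate tensor `ε = (∇u + ∇uᵀ) / 2`. -/
def strainRate {d : ℕ} (M : Matrix (Fin d) (Fin d) ℝ) : Matrix (Fin d) (Fin d) ℝ :=
  (1 / 2 : ℝ) • (M + M.transpose)

/-- The second invariant `ε_II = (ε : ε / 2)^{1/2}`. -/
def secondInvariant {d : ℕ} (e : Matrix (Fin d) (Fin d) ℝ) : ℝ :=
  Real.sqrt (1 / 2 * contraction e e)

/-! ### The Sobolev spaces `H¹(Ω)^d` and `H¹₀(Ω)^d` -/

/-- `G` is the weak gradient of `u` on `Ω`:
`∫_Ω u_i ∂_j ψ = - ∫_Ω G_{ij} ψ` for all test functions `ψ`. -/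
def IsWeakGradient {d : ℕ} (Ω : Opens (Vec d)) (w : L2Pair Ω) : Prop :=
  ∀ (ψ : 𝓓(Ω, ℝ)) (i j : Fin d),
    ∫ x in (Ω : Set (Vec d)), w.1 x i * fderiv ℝ ψ x (EuclideanSpace.single j 1) =
      - ∫ x in (Ω : Set (Vec d)), gradMatrix (w.2 x) i j * ψ x

lemma integrable_coord_mul_test {d : ℕ} (Ω : Opens (Vec d)) (w : L2Pair Ω)
    (ψ : 𝓓(Ω, ℝ)) (i j : Fin d) :
    Integrable (fun x => w.1 x i * fderiv ℝ ψ x (EuclideanSpace.single j 1))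
      (volume.restrict (Ω : Set (Vec d))) := by
  have h1 : MemLp (fun x => w.1 x i) 2 (volume.restrict (Ω : Set (Vec d))) :=
    (EuclideanSpace.proj i : Vec d →L[ℝ] ℝ).comp_memLp' (Lp.memLp w.1)
  have h2 : MemLp (fun x => fderiv ℝ ψ x (EuclideanSpace.single j 1)) 2
      (volume.restrict (Ω : Set (Vec d))) :=
    Continuous.memLp_of_hasCompactSupport
      ((ψ.contDiff.continuous_fderiv (by simp)).clm_apply continuous_const)
      (ψ.hasCompactSupport.fderiv_apply (𝕜 := ℝ) _)
  exact h1.integrable_mul h2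

lemma integrable_grad_mul_test {d : ℕ} (Ω : Opens (Vec d)) (w : L2Pair Ω)
    (ψ : 𝓓(Ω, ℝ)) (i j : Fin d) :
    Integrable (fun x => gradMatrix (w.2 x) i j * ψ x)
      (volume.restrict (Ω : Set (Vec d))) := by
  have h1 : MemLp (fun x => gradMatrix (w.2 x) i j) 2 (volume.restrict (Ω : Set (Vec d))) :=
    ((EuclideanSpace.proj i : Vec d →L[ℝ] ℝ).comp
      (ContinuousLinearMap.apply ℝ (Vec d)
        (EuclideanSpace.single j 1 : Vec d))).comp_memLp' (Lp.memLp w.2)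
  have h2 : MemLp (fun x => ψ x) 2 (volume.restrict (Ω : Set (Vec d))) :=
    Continuous.memLp_of_hasCompactSupport ψ.continuous ψ.hasCompactSupport
  exact h1.integrable_mul h2

/-- `H¹(Ω)^d`, each field being paired with its weak gradient. -/
def H1 {d : ℕ} (Ω : Opens (Vec d)) : Submodule ℝ (L2Pair Ω) where
  carrier := {w | IsWeakGradient Ω w}
  zero_mem' := by
    intro ψ i j
    have h1 := Lp.coeFn_zero (Vec d) 2 (volume.restrict (Ω : Set (Vec d)))
    have h2 := Lp.coeFn_zero (Jac d) 2 (volume.restrict (Ω : Set (Vec d)))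
    rw [integral_eq_zero_of_ae, integral_eq_zero_of_ae, neg_zero]
    · filter_upwards [h2] with x hx
      have hx' : (0 : L2Pair Ω).2 x = 0 := hx
      simp only [hx', gradMatrix]
      simp
    · filter_upwards [h1] with x hx
      have hx' : (0 : L2Pair Ω).1 x = 0 := hx
      simp only [hx']
      simp
  add_mem' := by
    intro a b ha hb ψ i j
    have h1 := Lp.coeFn_add a.1 b.1
    have h2 := Lp.coeFn_add a.2 b.2
    have e1 : ∫ x in (Ω : Set (Vec d)), (a + b).1 x i *
          fderiv ℝ ψ x (EuclideanSpace.single j 1) =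
        ∫ x in (Ω : Set (Vec d)), (a.1 x i * fderiv ℝ ψ x (EuclideanSpace.single j 1) +
          b.1 x i * fderiv ℝ ψ x (EuclideanSpace.single j 1)) := by
      refine integral_congr_ae ?_
      filter_upwards [h1] with x hx
      have hx' : (a + b).1 x = a.1 x + b.1 x := hx
      simp only [hx', PiLp.add_apply, add_mul]
    have e2 : ∫ x in (Ω : Set (Vec d)), gradMatrix ((a + b).2 x) i j * ψ x =
        ∫ x in (Ω : Set (Vec d)), (gradMatrix (a.2 x) i j * ψ x +
          gradMatrix (b.2 x) i j * ψ x) := by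
      refine integral_congr_ae ?_
      filter_upwards [h2] with x hx
      have hx' : (a + b).2 x = a.2 x + b.2 x := hx
      simp only [hx', gradMatrix, Matrix.of_apply, _root_.add_apply, PiLp.add_apply, add_mul]
    rw [e1, e2, integral_add (integrable_coord_mul_test Ω a ψ i j)
      (integrable_coord_mul_test Ω b ψ i j), integral_add (integrable_grad_mul_test Ω a ψ i j)
      (integrable_grad_mul_test Ω b ψ i j), ha ψ i j, hb ψ i j]
    ring
  smul_mem' := by
    intro c a ha ψ i j
    have h1 := Lp.coeFn_smul c a.1
    have h2 := Lp.coeFn_smul c a.2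
    have e1 : ∫ x in (Ω : Set (Vec d)), (c • a).1 x i *
          fderiv ℝ ψ x (EuclideanSpace.single j 1) =
        ∫ x in (Ω : Set (Vec d)), c * (a.1 x i *
          fderiv ℝ ψ x (EuclideanSpace.single j 1)) := by
      refine integral_congr_ae ?_
      filter_upwards [h1] with x hx
      simp [hx, mul_assoc]
    have e2 : ∫ x in (Ω : Set (Vec d)), gradMatrix ((c • a).2 x) i j * ψ x =
        ∫ x in (Ω : Set (Vec d)), c * (gradMatrix (a.2 x) i j * ψ x) := by
      refine integral_congr_ae ?_
      filter_upwards [h2] with x hx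
      simp [hx, gradMatrix, mul_assoc]
    rw [e1, e2, integral_const_mul, integral_const_mul, ha ψ i j]
    ring

/-- The smooth compactly supported fields on `Ω`, paired with their gradients. -/
def testFields {d : ℕ} (Ω : Opens (Vec d)) : Submodule ℝ (L2Pair Ω) where
  carrier := {w | ∃ φ : 𝓓(Ω, Vec d),
    w.1 =ᵐ[volume.restrict (Ω : Set (Vec d))] φ ∧
    w.2 =ᵐ[volume.restrict (Ω : Set (Vec d))] fderiv ℝ φ}
  zero_mem' := by
    refine ⟨0, Lp.coeFn_zero _ _ _, ?_⟩
    filter_upwards [Lp.coeFn_zero (Jac d) 2 (volume.restrict (Ω : Set (Vec d)))] with x hx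
    have : fderiv ℝ ((0 : 𝓓(Ω, Vec d)) : Vec d → Vec d) x = 0 := by
      change fderiv ℝ (fun _ => (0 : Vec d)) x = 0
      simp
    rw [this]
    exact hx
  add_mem' := by
    rintro a b ⟨φ, h1, h2⟩ ⟨ψ, h3, h4⟩
    refine ⟨φ + ψ, ?_, ?_⟩
    · filter_upwards [h1, h3, Lp.coeFn_add a.1 b.1] with x e1 e3 e5
      have e6 : (a + b).1 x = a.1 x + b.1 x := e5
      rw [e6, e1, e3]
      rfl
    · filter_upwards [h2, h4, Lp.coeFn_add a.2 b.2] with x e2 e4 e5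
      have : fderiv ℝ (φ + ψ : 𝓓(Ω, Vec d)) x = fderiv ℝ φ x + fderiv ℝ ψ x :=
        fderiv_add ((φ.contDiff.differentiable (by simp)) x)
          ((ψ.contDiff.differentiable (by simp)) x)
      have e6 : (a + b).2 x = a.2 x + b.2 x := e5
      rw [e6, e2, e4, this]
  smul_mem' := by
    rintro c a ⟨φ, h1, h2⟩
    refine ⟨c • φ, ?_, ?_⟩
    · filter_upwards [h1, Lp.coeFn_smul c a.1] with x e1 e5
      simp [e5, e1]
    · filter_upwards [h2, Lp.coeFn_smul c a.2] with x e2 e5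
      have : fderiv ℝ (c • φ : 𝓓(Ω, Vec d)) x = c • fderiv ℝ φ x :=
        fderiv_const_smul ((φ.contDiff.differentiable (by simp)) x) c
      have e6 : (c • a).2 x = c • a.2 x := e5
      rw [e6, e2, this]

/-- `H¹₀(Ω)^d`: the closure in `H¹(Ω)^d` of the smooth compactly supported fields. The `H¹` norm
is equivalent to the norm of `L2Pair Ω`. -/
def H10 {d : ℕ} (Ω : Opens (Vec d)) : Submodule ℝ (L2Pair Ω) :=
  H1 Ω ⊓ (testFields Ω).topologicalClosure

/-- The velocity of an element of `H¹₀(Ω)^d`. -/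
def vel {d : ℕ} {Ω : Opens (Vec d)} (u : H10 Ω) (x : Vec d) : Vec d := u.1.1 x

/-- The weak gradient `∇u`, as a matrix field. -/
def grad {d : ℕ} {Ω : Opens (Vec d)} (u : H10 Ω) (x : Vec d) : Matrix (Fin d) (Fin d) ℝ :=
  gradMatrix (u.1.2 x)

/-- The strain rate `ε(u)`. -/
def strain {d : ℕ} {Ω : Opens (Vec d)} (u : H10 Ω) (x : Vec d) : Matrix (Fin d) (Fin d) ℝ :=
  strainRate (grad u x)

/-- The second invariant `ε_II(u)` of the strain rate. -/
def strainII {d : ℕ} {Ω : Opens (Vec d)} (u : H10 Ω) (x : Vec d) : ℝ :=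
  secondInvariant (strain u x)

/-- The divergence-free fields in `H¹₀(Ω)^d`. -/
def solenoidal {d : ℕ} (Ω : Opens (Vec d)) : Submodule ℝ (H10 Ω) where
  carrier := {u | ∀ᵐ x ∂(volume.restrict (Ω : Set (Vec d))), (grad u x).trace = 0}
  zero_mem' := by
    filter_upwards [Lp.coeFn_zero (Jac d) 2 (volume.restrict (Ω : Set (Vec d)))] with x hx
    have hx' : (0 : H10 Ω).1.2 x = 0 := hx
    simp only [grad, hx']
    simp [gradMatrix, Matrix.trace]
  add_mem' := by
    rintro a b ha hb
    filter_upwards [ha, hb, Lp.coeFn_add a.1.2 b.1.2] with x h1 h2 h3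
    simp only [grad, gradMatrix, Matrix.trace, Matrix.diag_apply, Matrix.of_apply] at h1 h2 ⊢
    have h4 : (a + b).1.2 x = a.1.2 x + b.1.2 x := h3
    simp only [h4, _root_.add_apply, PiLp.add_apply, Finset.sum_add_distrib, h1, h2, add_zero]
  smul_mem' := by
    rintro c a ha
    filter_upwards [ha, Lp.coeFn_smul c a.1.2] with x h1 h3
    simp only [grad, gradMatrix, Matrix.trace, Matrix.diag_apply, Matrix.of_apply] at h1 ⊢
    simp [h3, ← Finset.mul_sum, h1]

/-! ### The two rheologies -/

/-- Ideal or composite von Mises rheology. -/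
inductive Rheology
  | ideal
  | composite

/-- The effective viscosity at second invariant `s ≥ 0`, with lower bound `m`, reference
viscosity `r` and yield stress `y`. In the ideal law `y / (2 s)` is `+∞` for `s = 0`, so that the
minimum is `r` there. -/
def viscosity (m r y s : ℝ) : Rheology → ℝ
  | .ideal => m + if s = 0 then r else min (y / (2 * s)) r
  | .composite => y * r / (2 * s * r + y)

/-- The functions `φ_i` and `φ_c`. -/
def phi (r y s : ℝ) : Rheology → ℝ
  | .ideal => if 2 * r * s ≤ y then 2 * r * s ^ 2 + y ^ 2 / (2 * r) else 2 * y * s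
  | .composite => 2 * y * s - y ^ 2 / r * Real.log (y + 2 * r * s)

/-- The expressions for the derivatives `φ_i'` and `φ_c'`. -/
def phiDeriv (r y s : ℝ) : Rheology → ℝ
  | .ideal => 2 * min (2 * r * s) y
  | .composite => 4 * r * y * s / (2 * r * s + y)

/-! ### Energy, first variation and weak form -/

/-- The energy `Φ(u) = ∫ φ(ε_II(u)) + 2 m ∫ ε_II(u)² - ∫ f · u`. -/
def energy {d : ℕ} (Ω : Opens (Vec d)) (law : Rheology) (m : ℝ) (μr τy : Vec d → ℝ)
    (f : Vec d → Vec d) (u : H10 Ω) : ℝ :=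
  (∫ x in (Ω : Set (Vec d)), phi (μr x) (τy x) (strainII u x) law)
    + 2 * m * (∫ x in (Ω : Set (Vec d)), strainII u x ^ 2)
    - ∫ x in (Ω : Set (Vec d)), inner ℝ (f x) (vel u x)

/-- The integrand `φ'(ε_II(u)) ε(u):ε(v) / (2 ε_II(u))`, which is zero where `ε(u) = 0`. -/
def phiVariation {d : ℕ} {Ω : Opens (Vec d)} (law : Rheology) (μr τy : Vec d → ℝ)
    (u v : H10 Ω) (x : Vec d) : ℝ :=
  phiDeriv (μr x) (τy x) (strainII u x) law *
    (contraction (strain u x) (strain v x) / (2 * strainII u x))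

/-- The expression
`∫ φ'(ε_II(u)) ε(u):ε(v) / (2 ε_II(u)) + ∫ 2 m ε(u):ε(v) - ∫ f · v`. -/
def firstVariation {d : ℕ} (Ω : Opens (Vec d)) (law : Rheology) (m : ℝ) (μr τy : Vec d → ℝ)
    (f : Vec d → Vec d) (u v : H10 Ω) : ℝ :=
  (∫ x in (Ω : Set (Vec d)), phiVariation law μr τy u v x)
    + (∫ x in (Ω : Set (Vec d)), 2 * m * contraction (strain u x) (strain v x))
    - ∫ x in (Ω : Set (Vec d)), inner ℝ (f x) (vel v x)

/-- The stress `μ(u) (∇u + ∇uᵀ)`. -/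
def stress {d : ℕ} {Ω : Opens (Vec d)} (law : Rheology) (m : ℝ) (μr τy : Vec d → ℝ)
    (u : H10 Ω) (x : Vec d) : Matrix (Fin d) (Fin d) ℝ :=
  viscosity m (μr x) (τy x) (strainII u x) law • (grad u x + (grad u x).transpose)

/-- `∫ μ(u) (∇u + ∇uᵀ) : ∇v - ∫ f · v`, the residual of the weak momentum equation tested with
a divergence-free field `v`. -/
def weakResidual {d : ℕ} (Ω : Opens (Vec d)) (law : Rheology) (m : ℝ) (μr τy : Vec d → ℝ)
    (f : Vec d → Vec d) (u v : H10 Ω) : ℝ :=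
  (∫ x in (Ω : Set (Vec d)), contraction (stress law m μr τy u x) (grad v x))
    - ∫ x in (Ω : Set (Vec d)), inner ℝ (f x) (vel v x)

/-- `u` is a velocity solution of the nonlinear Stokes problem: `u ∈ H¹₀(Ω)^d` is divergence-free
and satisfies the weak momentum equation for all divergence-free test fields in `H¹₀(Ω)^d`. -/
def IsVelocitySolution {d : ℕ} (Ω : Opens (Vec d)) (law : Rheology) (m : ℝ)
    (μr τy : Vec d → ℝ) (f : Vec d → Vec d) (u : H10 Ω) : Prop :=
  u ∈ solenoidal Ω ∧ ∀ v ∈ solenoidal Ω, weakResidual Ω law m μr τy f u v = 0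

/-- `(u, p)` solves the nonlinear Stokes system `-∇·[μ(u)(∇u + ∇uᵀ)] + ∇p = f`, `∇·u = 0`
in the sense of distributions. -/
def IsStokesPair {d : ℕ} (Ω : Opens (Vec d)) (law : Rheology) (m : ℝ)
    (μr τy : Vec d → ℝ) (f : Vec d → Vec d) (u : H10 Ω) (p : Vec d → ℝ) : Prop :=
  u ∈ solenoidal Ω ∧ ∀ v : 𝓓(Ω, Vec d),
    (∫ x in (Ω : Set (Vec d)), contraction (stress law m μr τy u x) (gradMatrix (fderiv ℝ v x)))
      - (∫ x in (Ω : Set (Vec d)), p x * (gradMatrix (fderiv ℝ v x)).trace)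
      = ∫ x in (Ω : Set (Vec d)), inner ℝ (f x) (v x)

/-- `u` is a critical point of `Φ` over the subspace `V`. -/
def IsCriticalPoint {X : Type*} [AddCommGroup X] [Module ℝ X] (Φ : X → ℝ) (V : Submodule ℝ X)
    (u : X) : Prop :=
  u ∈ V ∧ ∀ v ∈ V, HasLineDerivAt ℝ Φ 0 u v

end Viscoplastic

end

/-!
With `a = ε(u) / √2`, viewed as a vector of Euclidean norm `ε_II(u)`, the energy density is the
convex function `a ↦ φ(‖a‖)`. As `φ'(0) = 0`, it is differentiable also at `a = 0`, and its gradient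
is bounded by `2 τ_y ∈ L²`. Hence the integral of the density is a finite convex functional of
`a ∈ L²`, which can be differentiated along lines under the integral sign. Up to the contribution of
the lower viscosity bound, the gradient of the density is `4 μ a`, so that the derivative of `Φ` is
the weak form of the momentum equation, and critical points of a convex functional are minimizers.
For a velocity-pressure pair the momentum equation says that two bounded functionals agree on
`C_c^∞(Ω)^d`, hence on its closure; the one containing the pressure vanishes on divergence-free
fields.
-/

namespace Viscoplastic

/-! ### Convex functionals -/

section ConvexFunctionals

variable {X : Type*} [AddCommGroup X] [Module ℝ X] {Φ : X → ℝ} {V : Submodule ℝ X} {u : X}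

lemma add_lineDeriv_le_of_convexOn {s : Set X} {w : X} {c : ℝ} (hΦ : ConvexOn ℝ s Φ)
    (hu : u ∈ s) (hw : w ∈ s) (hc : HasLineDerivAt ℝ Φ c u (w - u)) : Φ u + c ≤ Φ w := by
  have hline := hΦ.comp_affineMap (AffineMap.lineMap (k := ℝ) u w)
  have hderiv : HasDerivAt (Φ ∘ AffineMap.lineMap (k := ℝ) u w) c 0 := by
    simpa only [HasLineDerivAt, Function.comp_def, AffineMap.lineMap_apply_module',
      add_comm] using hc
  have hslope := hline.le_slope_of_hasDerivAt (by simpa) (by simpa) one_pos hderiv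
  simp only [slope_def_field, Function.comp_apply, AffineMap.lineMap_apply_one,
    AffineMap.lineMap_apply_zero, sub_zero, div_one] at hslope
  linarith

lemma isCriticalPoint_iff_isMinOn (hΦ : ConvexOn ℝ V Φ)
    (hd : ∀ v ∈ V, LineDifferentiableAt ℝ Φ u v) :
    IsCriticalPoint Φ V u ↔ u ∈ V ∧ IsMinOn Φ V u := by
  refine and_congr_right fun hu => ⟨fun hcrit w hw => ?_, fun hmin v hv => ?_⟩
  · simpa using add_lineDeriv_le_of_convexOn hΦ hu hw (hcrit _ (V.sub_mem hw hu))
  · have hline : ∀ t : ℝ, u + t • v ∈ (V : Set X) := fun t => V.add_mem hu (V.smul_mem t hv)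
    have hderiv := (hd v hv).hasLineDerivAt
    rwa [hmin.hasLineDerivAt_eq_zero hderiv (.of_forall hline)] at hderiv

lemma isCriticalPoint_iff_of_hasLineDerivAt {L : X → ℝ}
    (hL : ∀ v ∈ V, HasLineDerivAt ℝ Φ (L v) u v) :
    IsCriticalPoint Φ V u ↔ u ∈ V ∧ ∀ v ∈ V, L v = 0 :=
  and_congr_right fun _ => forall₂_congr fun v hv =>
    ⟨fun h => (hL v hv).unique h, fun h => h ▸ hL v hv⟩

end ConvexFunctionals

/-! ### The functions `φ_i` and `φ_c` -/

section Rheology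

variable (law : Rheology) {r y s : ℝ}

lemma hasDerivAt_max_zero_sq (x : ℝ) : HasDerivAt (fun t : ℝ => max t 0 ^ 2) (2 * max x 0) x := by
  rcases lt_trichotomy x 0 with hx | rfl | hx
  · have hzero : (fun t : ℝ => max t 0 ^ 2) =ᶠ[nhds x] fun _ => 0 := by
      filter_upwards [eventually_lt_nhds hx] with t ht
      simp [ht.le]
    simpa [hx.le] using (hasDerivAt_const x (0 : ℝ)).congr_of_eventuallyEq hzero
  · have hbound : (fun t : ℝ => max t 0 ^ 2) =O[nhds 0] fun t => ‖t - 0‖ ^ 2 := by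
      refine .of_bound 1 (.of_forall fun t => ?_)
      rcases max_cases t 0 with h | h <;> simp [h.1, sq_nonneg]
    simpa using (hbound.hasFDerivAt one_lt_two).hasDerivAt
  · have hsq : (fun t : ℝ => max t 0 ^ 2) =ᶠ[nhds x] fun t => t ^ 2 := by
      filter_upwards [eventually_gt_nhds hx] with t ht
      rw [max_eq_left ht.le]
    simpa [hx.le] using (hasDerivAt_pow 2 x).congr_of_eventuallyEq hsq

lemma phi_ideal_eq (hr : r ≠ 0) :
    phi r y s .ideal = 2 * y * s + max (y - 2 * r * s) 0 ^ 2 / (2 * r) := by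
  simp only [phi]
  split_ifs with h
  · rw [max_eq_left (sub_nonneg.2 h)]
    field_simp
    ring
  · simp [max_eq_right (sub_nonpos.2 (not_le.1 h).le)]

lemma hasDerivAt_phi_ideal (hr : r ≠ 0) :
    HasDerivAt (fun s => phi r y s .ideal) (phiDeriv r y s .ideal) s := by
  simp only [phi_ideal_eq hr]
  have hlin : HasDerivAt (fun s : ℝ => y - 2 * r * s) (-(2 * r)) s := by
    simpa using ((hasDerivAt_id s).const_mul (2 * r)).const_sub y
  have hsq := ((hasDerivAt_max_zero_sq _).comp s hlin).div_const (2 * r)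
  refine (((hasDerivAt_id s).const_mul (2 * y)).add hsq).congr_deriv ?_
  have hmin : min (2 * r * s) y = y - max (y - 2 * r * s) 0 := by
    rw [← min_sub_sub_left]
    simp
  rw [phiDeriv, hmin]
  field_simp
  ring

lemma hasDerivAt_phi_composite (hr : r ≠ 0) (hs : y + 2 * r * s ≠ 0) :
    HasDerivAt (fun s => phi r y s .composite) (phiDeriv r y s .composite) s := by
  have hlin : HasDerivAt (fun s : ℝ => y + 2 * r * s) (2 * r) s := by
    simpa using ((hasDerivAt_id s).const_mul (2 * r)).const_add y
  refine (((hasDerivAt_id s).const_mul (2 * y)).sub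
    ((hlin.log hs).const_mul (y ^ 2 / r))).congr_deriv ?_
  have hs' : 2 * r * s + y ≠ 0 := by rwa [add_comm]
  rw [phiDeriv]
  field_simp
  ring

lemma hasDerivAt_phi (hr : 0 < r) (hy : 0 < y) (hs : 0 ≤ s) :
    HasDerivAt (fun s => phi r y s law) (phiDeriv r y s law) s := by
  cases law with
  | ideal => exact hasDerivAt_phi_ideal hr.ne'
  | composite => exact hasDerivAt_phi_composite hr.ne' (by positivity)

lemma phiDeriv_zero (hy : 0 ≤ y) : phiDeriv r y 0 law = 0 := by
  cases law <;> simp [phiDeriv, hy]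

lemma monotoneOn_phiDeriv (hr : 0 ≤ r) (hy : 0 < y) :
    MonotoneOn (fun s => phiDeriv r y s law) (Set.Ici 0) := by
  intro s hs t ht hst
  simp only [Set.mem_Ici] at hs ht
  cases law with
  | ideal => simp only [phiDeriv]; gcongr
  | composite =>
    simp only [phiDeriv]
    rw [div_le_div_iff₀ (by positivity) (by positivity)]
    have hgap : 0 ≤ 4 * r * y ^ 2 * (t - s) := mul_nonneg (by positivity) (sub_nonneg.2 hst)
    linarith

lemma phiDeriv_nonneg (hr : 0 ≤ r) (hy : 0 ≤ y) (hs : 0 ≤ s) : 0 ≤ phiDeriv r y s law := by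
  cases law <;> simp only [phiDeriv] <;> positivity

lemma phiDeriv_le_two_mul (hr : 0 ≤ r) (hy : 0 < y) (hs : 0 ≤ s) :
    phiDeriv r y s law ≤ 2 * y := by
  cases law with
  | ideal => simp [phiDeriv]
  | composite =>
    rw [phiDeriv, div_le_iff₀ (by positivity)]
    linarith [mul_pos hy hy]

lemma continuousOn_phiDeriv (hr : 0 ≤ r) (hy : 0 < y) :
    ContinuousOn (fun s => phiDeriv r y s law) (Set.Ici 0) := by
  cases law with
  | ideal => simp only [phiDeriv]; fun_prop
  | composite =>
    simp only [phiDeriv]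
    refine ContinuousOn.div (by fun_prop) (by fun_prop) fun s (hs : 0 ≤ s) => ?_
    positivity

lemma hasDerivWithinAt_phi (hr : 0 < r) (hy : 0 < y) :
    ∀ s ∈ Set.Ici (0 : ℝ),
      HasDerivWithinAt (fun s => phi r y s law) (phiDeriv r y s law) (Set.Ici 0) s :=
  fun _ hs => (hasDerivAt_phi law hr hy hs).hasDerivWithinAt

lemma contDiffOn_phi (hr : 0 < r) (hy : 0 < y) :
    ContDiffOn ℝ 1 (fun s => phi r y s law) (Set.Ici 0) := by
  have hderiv := hasDerivWithinAt_phi law hr hy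
  rw [contDiffOn_one_iff_derivWithin (uniqueDiffOn_Ici 0)]
  exact ⟨fun s hs => (hderiv s hs).differentiableWithinAt,
    (continuousOn_phiDeriv law hr.le hy).congr fun s hs =>
      (hderiv s hs).derivWithin (uniqueDiffOn_Ici 0 s hs)⟩

lemma convexOn_phi (hr : 0 < r) (hy : 0 < y) :
    ConvexOn ℝ (Set.Ici 0) (fun s => phi r y s law) := by
  have hderiv : ∀ s ∈ interior (Set.Ici (0 : ℝ)),
      HasDerivAt (fun s => phi r y s law) (phiDeriv r y s law) s :=
    fun s hs => hasDerivAt_phi law hr hy (interior_subset hs)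
  refine MonotoneOn.convexOn_of_deriv (convex_Ici 0) (contDiffOn_phi law hr hy).continuousOn
    (fun s hs => (hderiv s hs).differentiableAt.differentiableWithinAt) ?_
  exact ((monotoneOn_phiDeriv law hr.le hy).mono interior_subset).congr
    fun s hs => (hderiv s hs).deriv.symm

lemma monotoneOn_phi (hr : 0 < r) (hy : 0 < y) :
    MonotoneOn (fun s => phi r y s law) (Set.Ici 0) :=
  monotoneOn_of_hasDerivWithinAt_nonneg (convex_Ici 0)
    (contDiffOn_phi law hr hy).continuousOn
    (fun _ hs => (hasDerivAt_phi law hr hy (interior_subset hs)).hasDerivWithinAt)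
    fun _ hs => phiDeriv_nonneg law hr.le hy.le (interior_subset hs)

lemma lipschitzOnWith_phi (hr : 0 < r) (hy : 0 < y) :
    LipschitzOnWith (Real.nnabs (2 * y)) (fun s => phi r y s law) (Set.Ici 0) := by
  refine (convex_Ici 0).lipschitzOnWith_of_nnnorm_hasDerivWithin_le
    (hasDerivWithinAt_phi law hr hy) fun s hs => ?_
  rw [← NNReal.coe_le_coe, coe_nnnorm, Real.coe_nnabs, abs_of_pos (by positivity),
    Real.norm_of_nonneg (phiDeriv_nonneg law hr.le hy.le hs)]
  exact phiDeriv_le_two_mul law hr.le hy hs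

lemma phiDeriv_div_add_eq_two_mul_viscosity {m : ℝ} (hm : law = .composite → m = 0)
    (hr : 0 ≤ r) (hy : 0 < y) (hs : 0 < s) :
    phiDeriv r y s law / (2 * s) + 2 * m = 2 * viscosity m r y s law := by
  cases law with
  | ideal =>
    have hr' : 2 * r * s / (2 * s) = r := by field_simp
    have hmin : min (2 * r * s) y / (2 * s) = min (y / (2 * s)) r := by
      rw [← min_div_div_right (by positivity), hr', min_comm]
    rw [phiDeriv, viscosity, if_neg hs.ne', mul_div_assoc, hmin]
    ring
  | composite =>
    rw [hm rfl, phiDeriv, viscosity]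
    field_simp
    ring

lemma measurable_phi : Measurable fun q : ℝ × ℝ × ℝ => phi q.1 q.2.1 q.2.2 law := by
  cases law with
  | ideal =>
    exact .ite (measurableSet_le (by fun_prop) (by fun_prop)) (by fun_prop) (by fun_prop)
  | composite => simp only [phi]; fun_prop

lemma measurable_phiDeriv : Measurable fun q : ℝ × ℝ × ℝ => phiDeriv q.1 q.2.1 q.2.2 law := by
  cases law <;> simp only [phiDeriv] <;> fun_prop

end Rheology

/-! ### Radial functions -/

section Radial

variable {E : Type*} [NormedAddCommGroup E]

lemma lipschitzWith_comp_norm {g : ℝ → ℝ} {C : NNReal} (hg : LipschitzOnWith C g (Set.Ici 0)) :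
    LipschitzWith C (fun a : E => g ‖a‖) :=
  .of_dist_le_mul fun a b => (hg.dist_le_mul _ (norm_nonneg a) _ (norm_nonneg b)).trans
    (mul_le_mul_of_nonneg_left ((dist_norm_norm_le a b).trans_eq (dist_eq_norm a b).symm)
      C.coe_nonneg)

lemma convexOn_comp_norm [NormedSpace ℝ E] {g : ℝ → ℝ} (hconv : ConvexOn ℝ (Set.Ici 0) g)
    (hmono : MonotoneOn g (Set.Ici 0)) : ConvexOn ℝ Set.univ (fun a : E => g ‖a‖) := by
  refine ⟨convex_univ, fun a _ b _ s t hs ht hst => ?_⟩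
  have hnorm : ‖s • a + t • b‖ ≤ s • ‖a‖ + t • ‖b‖ :=
    convexOn_univ_norm.2 (Set.mem_univ a) (Set.mem_univ b) hs ht hst
  exact (hmono (norm_nonneg _) ((norm_nonneg _).trans hnorm) hnorm).trans
    (hconv.2 (norm_nonneg a) (norm_nonneg b) hs ht hst)

variable [InnerProductSpace ℝ E] {a : E}

lemma hasFDerivAt_norm_of_ne_zero (ha : a ≠ 0) :
    HasFDerivAt (fun b : E => ‖b‖) (‖a‖⁻¹ • innerSL ℝ a) a := by
  have hsqrt := (hasStrictFDerivAt_norm_sq a).hasFDerivAt.sqrt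
    (pow_ne_zero 2 (norm_ne_zero_iff.2 ha))
  simp only [Real.sqrt_sq (norm_nonneg _)] at hsqrt
  refine hsqrt.congr_fderiv ?_
  ext b
  simp only [_root_.smul_apply, innerSL_apply_apply, smul_eq_mul, nsmul_eq_mul, Nat.cast_ofNat]
  field_simp

lemma hasFDerivAt_comp_norm {g : ℝ → ℝ} {g' : ℝ} (hg : HasDerivAt g g' ‖a‖)
    (hzero : a = 0 → g' = 0) :
    HasFDerivAt (fun b : E => g ‖b‖) (innerSL ℝ ((g' / ‖a‖) • a)) a := by
  rcases eq_or_ne a 0 with rfl | ha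
  · have hnorm : (fun b : E => ‖b‖ - ‖(0 : E)‖) =O[nhds 0] fun b => b - 0 :=
      .of_bound 1 (.of_forall fun b => by simp)
    have hlittle := (hasDerivAt_iff_isLittleO.1 hg).comp_tendsto
      (continuous_norm.tendsto (0 : E))
    rw [hzero rfl] at hlittle
    simpa [hasFDerivAt_iff_isLittleO, Function.comp_def] using hlittle.trans_isBigO hnorm
  · refine (hg.comp_hasFDerivAt a (hasFDerivAt_norm_of_ne_zero ha)).congr_fderiv ?_
    rw [map_smul, smul_smul, div_eq_mul_inv]

end Radial

section PhiNorm

variable {E : Type*} [NormedAddCommGroup E] [InnerProductSpace ℝ E] (law : Rheology) {r y : ℝ}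

/-- The gradient of `a ↦ φ(‖a‖)` at `a`. As `0 / 0 = 0`, it is zero at `a = 0`, where `φ'`
vanishes too. -/
noncomputable def phiGrad (law : Rheology) (r y : ℝ) (a : E) : E :=
  (phiDeriv r y ‖a‖ law / ‖a‖) • a

lemma hasFDerivAt_phi_norm (hr : 0 < r) (hy : 0 < y) (a : E) :
    HasFDerivAt (fun b : E => phi r y ‖b‖ law) (innerSL ℝ (phiGrad law r y a)) a := by
  refine hasFDerivAt_comp_norm (hasDerivAt_phi law hr hy (norm_nonneg a)) ?_
  rintro rfl
  rw [norm_zero, phiDeriv_zero law hy.le]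

lemma convexOn_phi_norm (hr : 0 < r) (hy : 0 < y) :
    ConvexOn ℝ Set.univ (fun a : E => phi r y ‖a‖ law) :=
  convexOn_comp_norm (convexOn_phi law hr hy) (monotoneOn_phi law hr hy)

lemma norm_phiGrad_le (hr : 0 ≤ r) (hy : 0 < y) (a : E) : ‖phiGrad law r y a‖ ≤ 2 * y := by
  have hnonneg := phiDeriv_nonneg law hr hy.le (norm_nonneg a)
  rw [phiGrad, norm_smul, Real.norm_of_nonneg (by positivity)]
  rw [div_mul_eq_mul_div]
  exact (div_le_of_le_mul₀ (norm_nonneg a) hnonneg le_rfl).trans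
    (phiDeriv_le_two_mul law hr hy (norm_nonneg a))

/-- The stress as a function of `a = ε(u) / √2`, scaled so that it is paired with `b = ε(v) / √2`:
the stress tensor is `2 μ ε(u)`, and `2 μ ε(u) : ε(v) = ⟨4 μ a, b⟩`. The multiple `4 μ a` is written
as the gradient of the energy density, which avoids a case distinction at `a = 0`. -/
noncomputable def stressVec (law : Rheology) (m r y : ℝ) (a : E) : E :=
  phiGrad law r y a + (4 * m) • a

lemma four_mul_viscosity_smul {m : ℝ} (hm : law = .composite → m = 0) (hr : 0 ≤ r) (hy : 0 < y)
    (a : E) : (4 * viscosity m r y ‖a‖ law) • a = stressVec law m r y a := by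
  rcases eq_or_ne a 0 with rfl | ha
  · simp [stressVec, phiGrad]
  · have hvisc := phiDeriv_div_add_eq_two_mul_viscosity law hm hr hy (norm_pos_iff.2 ha)
    rw [stressVec, phiGrad, ← add_smul]
    congr 1
    linear_combination (-2) * hvisc

end PhiNorm

/-! ### Integral functionals -/

section IntegralFunctionals

variable {α E : Type*} [MeasurableSpace α] {μ : Measure α} [NormedAddCommGroup E]
  {F : α → E → ℝ} {K : α → ℝ} {p q : ENNReal}

/-- `F x` is Lipschitz continuous with constant `K x` for almost every `x`, where `K ∈ L^p`, and
`F(·, 0)` is integrable: then `a ↦ ∫ F(x, a(x)) dx` is finite on `L^q` for the conjugate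
exponent `q`. -/
structure IsLipschitzIntegrand (F : α → E → ℝ) (K : α → ℝ) (p : ENNReal) (μ : Measure α) :
    Prop where
  aestronglyMeasurable_comp : ∀ {a : α → E}, AEStronglyMeasurable a μ →
    AEStronglyMeasurable (fun x => F x (a x)) μ
  memLp_const : MemLp K p μ
  lipschitzWith : ∀ᵐ x ∂μ, LipschitzWith (Real.nnabs (K x)) (F x)
  integrable_zero : Integrable (fun x => F x 0) μ

namespace IsLipschitzIntegrand

lemma integrable [ENNReal.HolderConjugate p q] (hF : IsLipschitzIntegrand F K p μ) {a : α → E}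
    (ha : MemLp a q μ) : Integrable (fun x => F x (a x)) μ := by
  have hdiff : Integrable (fun x => F x (a x) - F x 0) μ := by
    refine (hF.memLp_const.norm.integrable_mul ha.norm).mono'
      ((hF.aestronglyMeasurable_comp ha.1).sub hF.integrable_zero.1) ?_
    filter_upwards [hF.lipschitzWith] with x hx
    simpa using hx.norm_sub_le (a x) 0
  exact (hdiff.add hF.integrable_zero).congr (.of_forall fun x => sub_add_cancel _ _)

lemma convexOn_integral [NormedSpace ℝ E] [ENNReal.HolderConjugate p q]
    (hF : IsLipschitzIntegrand F K p μ) (hconv : ∀ᵐ x ∂μ, ConvexOn ℝ Set.univ (F x)) :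
    ConvexOn ℝ Set.univ (fun a : Lp E q μ => ∫ x, F x (a x) ∂μ) := by
  refine ⟨convex_univ, fun a _ b _ s t hs ht hst => ?_⟩
  have ha := (hF.integrable (Lp.memLp a)).const_mul s
  have hb := (hF.integrable (Lp.memLp b)).const_mul t
  rw [smul_eq_mul, smul_eq_mul, ← integral_const_mul, ← integral_const_mul, ← integral_add ha hb]
  refine integral_mono_ae (hF.integrable (Lp.memLp _)) (ha.add hb) ?_
  filter_upwards [hconv, Lp.coeFn_add (s • a) (t • b), Lp.coeFn_smul s a, Lp.coeFn_smul t b]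
    with x hx hadd hsa htb
  rw [hadd, Pi.add_apply, hsa, htb]
  exact hx.2 (Set.mem_univ _) (Set.mem_univ _) hs ht hst

lemma hasLineDerivAt_integral [NormedSpace ℝ E] [ENNReal.HolderConjugate p q]
    (hF : IsLipschitzIntegrand F K p μ) {a : Lp E q μ} {F' : α → E →L[ℝ] ℝ}
    (hF'_meas : AEStronglyMeasurable F' μ) (hF' : ∀ᵐ x ∂μ, HasFDerivAt (F x) (F' x) (a x))
    (b : Lp E q μ) :
    HasLineDerivAt ℝ (fun a : Lp E q μ => ∫ x, F x (a x) ∂μ) (∫ x, F' x (b x) ∂μ) a b := by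
  have hline : ∀ t : ℝ, MemLp (fun x => a x + t • b x) q μ :=
    fun t => (Lp.memLp a).add ((Lp.memLp b).const_smul t)
  have hcoe : ∀ t : ℝ, ∫ x, F x ((a + t • b : Lp E q μ) x) ∂μ = ∫ x, F x (a x + t • b x) ∂μ := by
    refine fun t => integral_congr_ae ?_
    filter_upwards [Lp.coeFn_add a (t • b), Lp.coeFn_smul t b] with x hadd hsmul
    rw [hadd, Pi.add_apply, hsmul, Pi.smul_apply]
  simp only [HasLineDerivAt, hcoe]
  refine (hasDerivAt_integral_of_dominated_loc_of_lip (s := Set.univ)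
    (F := fun (t : ℝ) x => F x (a x + t • b x)) (bound := fun x => K x * ‖b x‖) Filter.univ_mem
    (.of_forall fun t => hF.aestronglyMeasurable_comp (hline t).1) (hF.integrable (hline 0))
    ((ContinuousLinearMap.id ℝ (E →L[ℝ] ℝ)).aestronglyMeasurable_comp₂ hF'_meas
      (Lp.aestronglyMeasurable b)) ?_
    (hF.memLp_const.integrable_mul (Lp.memLp b).norm) ?_).2
  · filter_upwards [hF.lipschitzWith] with x hx
    refine LipschitzOnWith.of_dist_le_mul fun s _ t _ => (hx.dist_le_mul _ _).trans_eq ?_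
    simp [dist_eq_norm, ← sub_smul, norm_smul, mul_assoc, mul_comm ‖b x‖]
  · filter_upwards [hF'] with x hx
    exact hx.hasLineDerivAt (b x)

end IsLipschitzIntegrand

lemma integrable_inner [InnerProductSpace ℝ E] [ENNReal.HolderConjugate p q] {f g : α → E}
    (hf : MemLp f p μ) (hg : MemLp g q μ) : Integrable (fun x => inner ℝ (f x) (g x)) μ :=
  memLp_one_iff_integrable.1 ((innerSL ℝ).memLp_of_bilin 1 hf hg)

lemma inner_toLp_left [InnerProductSpace ℝ E] {f : α → E} (hf : MemLp f 2 μ) (w : Lp E 2 μ) :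
    inner ℝ (hf.toLp f) w = ∫ x, inner ℝ (f x) (w x) ∂μ := by
  rw [L2.inner_def]
  refine integral_congr_ae ?_
  filter_upwards [hf.coeFn_toLp] with x hx
  rw [hx]

end IntegralFunctionals

/-! ### Admissible coefficients -/

section Admissible

variable {α E : Type*} [MeasurableSpace α] {μ : Measure α} [NormedAddCommGroup E]
  (law : Rheology) {r y : α → ℝ} {a : α → E}

/-- Positive measurable coefficients `r` (reference viscosity) and `y` (yield stress) with
`y ∈ L²`, positivity being required almost everywhere only. -/
structure AdmissibleCoefficients (μ : Measure α) (r y : α → ℝ) : Prop where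
  viscosity_pos : ∀ᵐ x ∂μ, 0 < r x
  yieldStress_pos : ∀ᵐ x ∂μ, 0 < y x
  aemeasurable_viscosity : AEMeasurable r μ
  memLp_yieldStress : MemLp y 2 μ

namespace AdmissibleCoefficients

lemma isLipschitzIntegrand_phi (h : AdmissibleCoefficients μ r y)
    (h0 : Integrable (fun x => phi (r x) (y x) 0 law) μ) :
    IsLipschitzIntegrand (fun x (a : E) => phi (r x) (y x) ‖a‖ law) (fun x => 2 * y x) 2 μ where
  aestronglyMeasurable_comp ha := ((measurable_phi law).comp_aemeasurable
    (h.aemeasurable_viscosity.prodMk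
      (h.memLp_yieldStress.1.aemeasurable.prodMk ha.norm.aemeasurable))).aestronglyMeasurable
  memLp_const := h.memLp_yieldStress.const_mul 2
  lipschitzWith := by
    filter_upwards [h.viscosity_pos, h.yieldStress_pos] with x hr hy
    exact lipschitzWith_comp_norm (lipschitzOnWith_phi law hr hy)
  integrable_zero := by simpa only [norm_zero] using h0

variable [InnerProductSpace ℝ E]

lemma memLp_phiGrad (h : AdmissibleCoefficients μ r y) (ha : AEStronglyMeasurable a μ) :
    MemLp (fun x => phiGrad law (r x) (y x) (a x)) 2 μ := by
  have hderiv : AEMeasurable (fun x => phiDeriv (r x) (y x) ‖a x‖ law) μ :=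
    (measurable_phiDeriv law).comp_aemeasurable (h.aemeasurable_viscosity.prodMk
      (h.memLp_yieldStress.1.aemeasurable.prodMk ha.norm.aemeasurable))
  refine (h.memLp_yieldStress.const_mul 2).mono'
    ((hderiv.div ha.norm.aemeasurable).aestronglyMeasurable.smul ha) ?_
  filter_upwards [h.viscosity_pos, h.yieldStress_pos] with x hr hy
  exact norm_phiGrad_le law hr.le hy (a x)

lemma memLp_stressVec (h : AdmissibleCoefficients μ r y) (m : ℝ) (ha : MemLp a 2 μ) :
    MemLp (fun x => stressVec law m (r x) (y x) (a x)) 2 μ :=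
  (h.memLp_phiGrad law ha.1).add (ha.const_smul (4 * m))

lemma convexOn_integral_phi (h : AdmissibleCoefficients μ r y)
    (h0 : Integrable (fun x => phi (r x) (y x) 0 law) μ) :
    ConvexOn ℝ Set.univ (fun a : Lp E 2 μ => ∫ x, phi (r x) (y x) ‖a x‖ law ∂μ) := by
  refine (h.isLipschitzIntegrand_phi law h0).convexOn_integral ?_
  filter_upwards [h.viscosity_pos, h.yieldStress_pos] with x hr hy
  exact convexOn_phi_norm law hr hy

lemma hasLineDerivAt_integral_phi (h : AdmissibleCoefficients μ r y)
    (h0 : Integrable (fun x => phi (r x) (y x) 0 law) μ) (a b : Lp E 2 μ) :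
    HasLineDerivAt ℝ (fun a : Lp E 2 μ => ∫ x, phi (r x) (y x) ‖a x‖ law ∂μ)
      (∫ x, inner ℝ (phiGrad law (r x) (y x) (a x)) (b x) ∂μ) a b := by
  refine (h.isLipschitzIntegrand_phi law h0).hasLineDerivAt_integral
    (F' := fun x => innerSL ℝ (phiGrad law (r x) (y x) (a x)))
    ((innerSL ℝ).continuous.comp_aestronglyMeasurable
      (h.memLp_phiGrad law (Lp.aestronglyMeasurable a)).1) ?_ b
  filter_upwards [h.viscosity_pos, h.yieldStress_pos] with x hr hy
  exact hasFDerivAt_phi_norm law hr hy (a x)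

end AdmissibleCoefficients

end Admissible

/-! ### Strain rates as vectors -/

section Strain

variable {d : ℕ}

/-- The normalised strain rate `ε / √2` of a Jacobian, as a vector: its Euclidean norm is the
second invariant `ε_II`. -/
noncomputable def strainVec (d : ℕ) : Jac d →L[ℝ] EuclideanSpace ℝ (Fin d × Fin d) :=
  LinearMap.toContinuousLinearMap
    { toFun := fun G => WithLp.toLp 2 fun q => √(1 / 2) * strainRate (gradMatrix G) q.1 q.2
      map_add' := fun G H => by
        ext q
        simp only [strainRate, gradMatrix, Matrix.smul_apply, Matrix.add_apply, Matrix.of_apply,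
          Matrix.transpose_apply, _root_.add_apply, PiLp.add_apply, smul_eq_mul]
        ring
      map_smul' := fun c G => by
        ext q
        simp only [strainRate, gradMatrix, Matrix.smul_apply, Matrix.add_apply, Matrix.of_apply,
          Matrix.transpose_apply, _root_.smul_apply, PiLp.smul_apply, smul_eq_mul,
          RingHom.id_apply]
        ring }

lemma strainVec_apply (G : Jac d) (q : Fin d × Fin d) :
    strainVec d G q = √(1 / 2) * strainRate (gradMatrix G) q.1 q.2 := rfl

lemma contraction_strainRate (G H : Jac d) :
    contraction (strainRate (gradMatrix G)) (strainRate (gradMatrix H)) =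
      2 * inner ℝ (strainVec d G) (strainVec d H) := by
  have hsqrt : √(1 / 2 : ℝ) * √(1 / 2) = 1 / 2 := Real.mul_self_sqrt (by norm_num)
  simp only [contraction, PiLp.inner_apply, strainVec_apply, Fintype.sum_prod_type,
    Finset.mul_sum]
  refine Finset.sum_congr rfl fun i _ => Finset.sum_congr rfl fun j _ => ?_
  simp only [RCLike.inner_apply, conj_trivial]
  linear_combination (-2 * strainRate (gradMatrix G) i j * strainRate (gradMatrix H) i j) * hsqrt

lemma secondInvariant_strainRate (G : Jac d) :
    secondInvariant (strainRate (gradMatrix G)) = ‖strainVec d G‖ := by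
  rw [secondInvariant, contraction_strainRate, real_inner_self_eq_norm_sq, ← mul_assoc,
    one_div_mul_cancel two_ne_zero, one_mul, Real.sqrt_sq (norm_nonneg _)]

lemma contraction_add_transpose (A B : Matrix (Fin d) (Fin d) ℝ) :
    contraction (A + A.transpose) B = 2 * contraction (strainRate A) (strainRate B) := by
  have hswap : ∑ i, ∑ j, (A i j + A j i) * B i j = ∑ i, ∑ j, (A i j + A j i) * B j i := by
    rw [Finset.sum_comm]
    simp only [add_comm]
  have hstrain : 2 * contraction (strainRate A) (strainRate B) =
      1 / 2 * (∑ i, ∑ j, (A i j + A j i) * B i j + ∑ i, ∑ j, (A i j + A j i) * B j i) := by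
    simp only [contraction, ← Finset.sum_add_distrib, Finset.mul_sum]
    refine Finset.sum_congr rfl fun i _ => Finset.sum_congr rfl fun j _ => ?_
    simp only [strainRate, Matrix.smul_apply, Matrix.add_apply, Matrix.transpose_apply, smul_eq_mul]
    ring
  rw [hstrain, ← hswap, ← two_mul, ← mul_assoc, one_div_mul_cancel two_ne_zero, one_mul]
  rfl

lemma smul_contraction (c : ℝ) (A B : Matrix (Fin d) (Fin d) ℝ) :
    contraction (c • A) B = c * contraction A B := by
  simp only [contraction, Matrix.smul_apply, smul_eq_mul, Finset.mul_sum, mul_assoc]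

lemma contraction_viscous_stress (law : Rheology) {m r y : ℝ} (hm : law = .composite → m = 0)
    (hr : 0 ≤ r) (hy : 0 < y) (G H : Jac d) :
    contraction (viscosity m r y (secondInvariant (strainRate (gradMatrix G))) law •
        (gradMatrix G + (gradMatrix G).transpose)) (gradMatrix H) =
      inner ℝ (stressVec law m r y (strainVec d G)) (strainVec d H) := by
  rw [smul_contraction, contraction_add_transpose, contraction_strainRate,
    secondInvariant_strainRate, ← four_mul_viscosity_smul law hm hr hy, real_inner_smul_left]
  ring

/-- The divergence `tr ∇u` of a Jacobian. -/
noncomputable def divergence (d : ℕ) : Jac d →L[ℝ] ℝ :=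
  ∑ i, (EuclideanSpace.proj i : Vec d →L[ℝ] ℝ).comp
    (ContinuousLinearMap.apply ℝ (Vec d) (EuclideanSpace.single i 1))

lemma divergence_apply (G : Jac d) : divergence d G = (gradMatrix G).trace := by
  simp [divergence, gradMatrix, Matrix.trace]

variable {Ω : Opens (Vec d)}

/-- The field `ε(u) / √2` of an `L²` pair `(u, ∇u)`, as an element of `L²`. -/
noncomputable def strainL2 (Ω : Opens (Vec d)) :
    L2Pair Ω →L[ℝ] Lp (EuclideanSpace ℝ (Fin d × Fin d)) 2 (volume.restrict (Ω : Set (Vec d))) :=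
  (strainVec d).compLpL 2 _ ∘L .snd ℝ _ _

lemma coeFn_strainL2 (w : L2Pair Ω) :
    strainL2 Ω w =ᵐ[volume.restrict (Ω : Set (Vec d))] fun x => strainVec d (w.2 x) :=
  ContinuousLinearMap.coeFn_compLpL _ _

lemma memLp_strainVec (w : L2Pair Ω) :
    MemLp (fun x => strainVec d (w.2 x)) 2 (volume.restrict (Ω : Set (Vec d))) :=
  (strainVec d).comp_memLp' (Lp.memLp w.2)

lemma strainII_eq_norm (u : H10 Ω) (x : Vec d) : strainII u x = ‖strainVec d (u.1.2 x)‖ :=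
  secondInvariant_strainRate _

lemma contraction_strain (u v : H10 Ω) (x : Vec d) :
    contraction (strain u x) (strain v x) =
      2 * inner ℝ (strainVec d (u.1.2 x)) (strainVec d (v.1.2 x)) :=
  contraction_strainRate _ _

lemma phiVariation_eq_inner (law : Rheology) (μr τy : Vec d → ℝ) (u v : H10 Ω) (x : Vec d) :
    phiVariation law μr τy u v x =
      inner ℝ (phiGrad law (μr x) (τy x) (strainVec d (u.1.2 x))) (strainVec d (v.1.2 x)) := by
  rw [phiVariation, contraction_strain, strainII_eq_norm, mul_div_mul_left _ _ two_ne_zero,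
    phiGrad, real_inner_smul_left]
  ring

end Strain

/-! ### The energy -/

section Energy

variable {d : ℕ} {Ω : Opens (Vec d)} (law : Rheology) {m : ℝ} {μr τy : Vec d → ℝ}
  {f : Vec d → Vec d}

lemma integrable_strainII_sq (u : H10 Ω) :
    Integrable (fun x => strainII u x ^ 2) (volume.restrict (Ω : Set (Vec d))) := by
  simpa only [strainII_eq_norm] using (memLp_strainVec u.1).norm.integrable_sq

lemma integrable_inner_vel (hf : MemLp f 2 (volume.restrict (Ω : Set (Vec d)))) (u : H10 Ω) :
    Integrable (fun x => inner ℝ (f x) (vel u x)) (volume.restrict (Ω : Set (Vec d))) :=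
  integrable_inner hf (Lp.memLp u.1.1)

lemma integrable_contraction_strain (u v : H10 Ω) :
    Integrable (fun x => contraction (strain u x) (strain v x))
      (volume.restrict (Ω : Set (Vec d))) := by
  simpa only [contraction_strain] using
    (integrable_inner (memLp_strainVec u.1) (memLp_strainVec v.1)).const_mul 2

lemma integral_strainII_sq (u : H10 Ω) :
    ∫ x in (Ω : Set (Vec d)), strainII u x ^ 2 = ‖strainL2 Ω u.1‖ ^ 2 := by
  rw [← real_inner_self_eq_norm_sq, L2.inner_def]
  refine integral_congr_ae ?_
  filter_upwards [coeFn_strainL2 u.1] with x hx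
  rw [hx, strainII_eq_norm, real_inner_self_eq_norm_sq]

lemma integral_contraction_strain (u v : H10 Ω) :
    ∫ x in (Ω : Set (Vec d)), contraction (strain u x) (strain v x) =
      2 * inner ℝ (strainL2 Ω u.1) (strainL2 Ω v.1) := by
  rw [L2.inner_def, ← integral_const_mul]
  refine integral_congr_ae ?_
  filter_upwards [coeFn_strainL2 u.1, coeFn_strainL2 v.1] with x hu hv
  rw [hu, hv, contraction_strain]

lemma energy_eq (hf : MemLp f 2 (volume.restrict (Ω : Set (Vec d)))) (u : H10 Ω) :
    energy Ω law m μr τy f u =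
      (∫ x in (Ω : Set (Vec d)), phi (μr x) (τy x) ‖strainL2 Ω u.1 x‖ law) +
        2 * m * ‖strainL2 Ω u.1‖ ^ 2 - inner ℝ (hf.toLp f) u.1.1 := by
  have hphi : ∫ x in (Ω : Set (Vec d)), phi (μr x) (τy x) (strainII u x) law =
      ∫ x in (Ω : Set (Vec d)), phi (μr x) (τy x) ‖strainL2 Ω u.1 x‖ law := by
    refine integral_congr_ae ?_
    filter_upwards [coeFn_strainL2 u.1] with x hx
    rw [hx, strainII_eq_norm]
  rw [energy, hphi, integral_strainII_sq, inner_toLp_left]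
  rfl

lemma firstVariation_eq (hf : MemLp f 2 (volume.restrict (Ω : Set (Vec d)))) (u v : H10 Ω) :
    firstVariation Ω law m μr τy f u v =
      (∫ x in (Ω : Set (Vec d)),
        inner ℝ (phiGrad law (μr x) (τy x) (strainL2 Ω u.1 x)) (strainL2 Ω v.1 x)) +
        2 * m * (2 * inner ℝ (strainL2 Ω u.1) (strainL2 Ω v.1)) -
          inner ℝ (hf.toLp f) v.1.1 := by
  have hphi : ∫ x in (Ω : Set (Vec d)), phiVariation law μr τy u v x =
      ∫ x in (Ω : Set (Vec d)),
        inner ℝ (phiGrad law (μr x) (τy x) (strainL2 Ω u.1 x)) (strainL2 Ω v.1 x) := by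
    refine integral_congr_ae ?_
    filter_upwards [coeFn_strainL2 u.1, coeFn_strainL2 v.1] with x hu hv
    rw [hu, hv, phiVariation_eq_inner]
  rw [firstVariation, hphi, integral_const_mul, integral_contraction_strain, inner_toLp_left]
  rfl

namespace AdmissibleCoefficients

lemma integrable_phi_strainII
    (h : AdmissibleCoefficients (volume.restrict (Ω : Set (Vec d))) μr τy)
    (h0 : IntegrableOn (fun x => phi (μr x) (τy x) 0 law) Ω) (u : H10 Ω) :
    Integrable (fun x => phi (μr x) (τy x) (strainII u x) law)
      (volume.restrict (Ω : Set (Vec d))) := by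
  simpa only [strainII_eq_norm] using
    (h.isLipschitzIntegrand_phi law h0).integrable (memLp_strainVec u.1)

lemma integrable_phiVariation
    (h : AdmissibleCoefficients (volume.restrict (Ω : Set (Vec d))) μr τy) (u v : H10 Ω) :
    Integrable (phiVariation law μr τy u v) (volume.restrict (Ω : Set (Vec d))) :=
  (integrable_inner (h.memLp_phiGrad law (memLp_strainVec u.1).1) (memLp_strainVec v.1)).congr
    (.of_forall fun x => (phiVariation_eq_inner law μr τy u v x).symm)

lemma contraction_stress_ae_eq
    (h : AdmissibleCoefficients (volume.restrict (Ω : Set (Vec d))) μr τy)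
    (hm : law = .composite → m = 0) (u : H10 Ω) (w : L2Pair Ω) :
    (fun x => contraction (stress law m μr τy u x) (gradMatrix (w.2 x)))
      =ᵐ[volume.restrict (Ω : Set (Vec d))] fun x =>
        inner ℝ (stressVec law m (μr x) (τy x) (strainVec d (u.1.2 x))) (strainVec d (w.2 x)) := by
  filter_upwards [h.viscosity_pos, h.yieldStress_pos] with x hr hy
  exact contraction_viscous_stress law hm hr.le hy _ _

lemma integrable_contraction_stress
    (h : AdmissibleCoefficients (volume.restrict (Ω : Set (Vec d))) μr τy)
    (hm : law = .composite → m = 0) (u : H10 Ω) (w : L2Pair Ω) :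
    Integrable (fun x => contraction (stress law m μr τy u x) (gradMatrix (w.2 x)))
      (volume.restrict (Ω : Set (Vec d))) :=
  (integrable_inner (h.memLp_stressVec law m (memLp_strainVec u.1)) (memLp_strainVec w)).congr
    (h.contraction_stress_ae_eq law hm u w).symm

lemma convexOn_energy (h : AdmissibleCoefficients (volume.restrict (Ω : Set (Vec d))) μr τy)
    (h0 : IntegrableOn (fun x => phi (μr x) (τy x) 0 law) Ω)
    (hf : MemLp f 2 (volume.restrict (Ω : Set (Vec d)))) (hm : 0 ≤ m) :
    ConvexOn ℝ Set.univ (energy Ω law m μr τy f) := by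
  have hphi := (h.convexOn_integral_phi law h0).comp_linearMap
    ((strainL2 Ω).toLinearMap ∘ₗ (H10 Ω).subtype)
  have hsq := ((convexOn_univ_norm.pow (fun _ _ => norm_nonneg _) 2).comp_linearMap
    ((strainL2 Ω).toLinearMap ∘ₗ (H10 Ω).subtype)).smul (mul_nonneg zero_le_two hm)
  have hload := ((innerSL ℝ (hf.toLp f)).toLinearMap ∘ₗ .fst ℝ _ _ ∘ₗ
    (H10 Ω).subtype).concaveOn convex_univ
  exact ((hphi.add hsq).sub hload).congr fun u _ => (energy_eq law hf u).symm

lemma hasLineDerivAt_energy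
    (h : AdmissibleCoefficients (volume.restrict (Ω : Set (Vec d))) μr τy)
    (h0 : IntegrableOn (fun x => phi (μr x) (τy x) 0 law) Ω)
    (hf : MemLp f 2 (volume.restrict (Ω : Set (Vec d)))) (u v : H10 Ω) :
    HasLineDerivAt ℝ (energy Ω law m μr τy f) (firstVariation Ω law m μr τy f u v) u v := by
  have hphi := h.hasLineDerivAt_integral_phi law h0 (strainL2 Ω u.1) (strainL2 Ω v.1)
  have hsq := ((hasStrictFDerivAt_norm_sq (strainL2 Ω u.1)).hasFDerivAt.hasLineDerivAt
    (strainL2 Ω v.1)).const_mul (2 * m)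
  have hload := (innerSL ℝ (hf.toLp f)).hasFDerivAt.hasLineDerivAt (x := u.1.1) v.1.1
  rw [firstVariation_eq law hf]
  refine ((hphi.add hsq).sub hload).congr_deriv ?_ |>.congr_of_eventuallyEq ?_
  · simp
  · refine .of_forall fun t => ?_
    simp [energy_eq law hf]

/-- The functional `w ↦ ∫ μ(u) (∇u + ∇uᵀ) : ∇w - ∫ f · w` on `L²` pairs. -/
noncomputable def residual
    (h : AdmissibleCoefficients (volume.restrict (Ω : Set (Vec d))) μr τy) (m : ℝ)
    (hf : MemLp f 2 (volume.restrict (Ω : Set (Vec d)))) (u : H10 Ω) : L2Pair Ω →L[ℝ] ℝ :=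
  innerSL ℝ ((h.memLp_stressVec law m (memLp_strainVec u.1)).toLp _) ∘L strainL2 Ω -
    innerSL ℝ (hf.toLp f) ∘L .fst ℝ _ _

lemma residual_apply (h : AdmissibleCoefficients (volume.restrict (Ω : Set (Vec d))) μr τy)
    (hm : law = .composite → m = 0) (hf : MemLp f 2 (volume.restrict (Ω : Set (Vec d))))
    (u : H10 Ω) (w : L2Pair Ω) :
    h.residual law m hf u w =
      (∫ x in (Ω : Set (Vec d)), contraction (stress law m μr τy u x) (gradMatrix (w.2 x))) -
        ∫ x in (Ω : Set (Vec d)), inner ℝ (f x) (w.1 x) := by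
  rw [integral_congr_ae (h.contraction_stress_ae_eq law hm u w), ← inner_toLp_left hf]
  refine congrArg (· - _) ((inner_toLp_left (h.memLp_stressVec law m (memLp_strainVec u.1))
    (strainL2 Ω w)).trans (integral_congr_ae ?_))
  filter_upwards [coeFn_strainL2 w] with x hx
  rw [hx]

lemma firstVariation_eq_weakResidual
    (h : AdmissibleCoefficients (volume.restrict (Ω : Set (Vec d))) μr τy)
    (hm : law = .composite → m = 0) (u v : H10 Ω) :
    firstVariation Ω law m μr τy f u v = weakResidual Ω law m μr τy f u v := by
  rw [firstVariation, weakResidual, ← integral_add (h.integrable_phiVariation law u v)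
    ((integrable_contraction_strain u v).const_mul _)]
  refine congrArg (· - _) (integral_congr_ae ?_)
  filter_upwards [h.contraction_stress_ae_eq law hm u v.1] with x hx
  rw [grad, hx, phiVariation_eq_inner, contraction_strain, stressVec, inner_add_left,
    real_inner_smul_left]
  ring

end AdmissibleCoefficients

end Energy

/-! ### The pressure -/

section Pressure

variable {d : ℕ} {Ω : Opens (Vec d)} {law : Rheology} {m : ℝ} {μr τy p : Vec d → ℝ}
  {f : Vec d → Vec d}

/-- The functional `w ↦ ∫ p ∇ · w` on `L²` pairs. -/
noncomputable def pressureWork (hp : MemLp p 2 (volume.restrict (Ω : Set (Vec d)))) :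
    L2Pair Ω →L[ℝ] ℝ :=
  innerSL ℝ (hp.toLp p) ∘L (divergence d).compLpL 2 _ ∘L .snd ℝ _ _

lemma pressureWork_apply (hp : MemLp p 2 (volume.restrict (Ω : Set (Vec d)))) (w : L2Pair Ω) :
    pressureWork hp w = ∫ x in (Ω : Set (Vec d)), p x * (gradMatrix (w.2 x)).trace := by
  refine (inner_toLp_left hp _).trans (integral_congr_ae ?_)
  filter_upwards [(divergence d).coeFn_compLpL w.2] with x hx
  exact (congrArg (inner ℝ (p x)) (hx.trans (divergence_apply _))).trans (mul_comm _ _)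

lemma pressureWork_eq_zero (hp : MemLp p 2 (volume.restrict (Ω : Set (Vec d)))) {v : H10 Ω}
    (hv : v ∈ solenoidal Ω) : pressureWork hp v.1 = 0 := by
  rw [pressureWork_apply]
  refine integral_eq_zero_of_ae ?_
  filter_upwards [hv] with x hx
  exact mul_eq_zero_of_right _ hx

lemma eq_on_H10_of_eq_on_testFields {L M : L2Pair Ω →L[ℝ] ℝ}
    (h : ∀ w ∈ testFields Ω, L w = M w) (v : H10 Ω) : L v.1 = M v.1 :=
  Set.EqOn.closure h L.continuous M.continuous v.2.2

lemma IsStokesPair.residual_eq_pressureWork {u : H10 Ω}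
    (hup : IsStokesPair Ω law m μr τy f u p)
    (h : AdmissibleCoefficients (volume.restrict (Ω : Set (Vec d))) μr τy)
    (hm : law = .composite → m = 0) (hf : MemLp f 2 (volume.restrict (Ω : Set (Vec d))))
    (hp : MemLp p 2 (volume.restrict (Ω : Set (Vec d)))) (v : H10 Ω) :
    h.residual law m hf u v.1 = pressureWork hp v.1 := by
  refine eq_on_H10_of_eq_on_testFields (fun w ⟨ψ, hvel, hgrad⟩ => ?_) v
  rw [h.residual_apply law hm, pressureWork_apply, sub_eq_iff_eq_add, ← sub_eq_iff_eq_add']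
  convert hup.2 ψ using 1
  · congr 1 <;> refine integral_congr_ae ?_ <;> filter_upwards [hgrad] with x hx <;> rw [hx]
  · refine integral_congr_ae ?_
    filter_upwards [hvel] with x hx
    rw [hx]

lemma IsStokesPair.isVelocitySolution {u : H10 Ω} (hup : IsStokesPair Ω law m μr τy f u p)
    (h : AdmissibleCoefficients (volume.restrict (Ω : Set (Vec d))) μr τy)
    (hm : law = .composite → m = 0) (hf : MemLp f 2 (volume.restrict (Ω : Set (Vec d))))
    (hp : MemLp p 2 (volume.restrict (Ω : Set (Vec d)))) :
    IsVelocitySolution Ω law m μr τy f u := by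
  refine ⟨hup.1, fun v hv => ?_⟩
  calc weakResidual Ω law m μr τy f u v
      = h.residual law m hf u v.1 := (h.residual_apply law hm hf u v.1).symm
    _ = pressureWork hp v.1 := hup.residual_eq_pressureWork h hm hf hp v
    _ = 0 := pressureWork_eq_zero hp hv

end Pressure

end Viscoplastic

open Viscoplastic in
theorem mainTheorem1_general :
    (∀ (law : Rheology) (r y : ℝ), 0 < r → 0 < y →
      ConvexOn ℝ (Set.Ici 0) (fun σ => phi r y σ law) ∧
      ContDiffOn ℝ 1 (fun σ => phi r y σ law) (Set.Ici 0) ∧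
      (∀ σ : ℝ, 0 ≤ σ → HasDerivWithinAt (fun s => phi r y s law)
        (phiDeriv r y σ law) (Set.Ici 0) σ) ∧
      (∀ m σ : ℝ, (law = Rheology.composite → m = 0) → 0 < σ →
        phiDeriv r y σ law / (2 * σ) + 2 * m = 2 * viscosity m r y σ law)) ∧
    (∀ (d : ℕ) (Ω : Opens (Vec d)) (law : Rheology) (m : ℝ) (μr τy : Vec d → ℝ)
      (f : Vec d → Vec d),
      0 ≤ m → (law = Rheology.composite → m = 0) →
      AdmissibleCoefficients (volume.restrict (Ω : Set (Vec d))) μr τy →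
      IntegrableOn (fun x => phi (μr x) (τy x) 0 law) Ω volume →
      MemLp f 2 (volume.restrict (Ω : Set (Vec d))) →
      (∀ u : H10 Ω,
        IntegrableOn (fun x => phi (μr x) (τy x) (strainII u x) law) Ω volume ∧
        IntegrableOn (fun x => strainII u x ^ 2) Ω volume ∧
        IntegrableOn (fun x => inner ℝ (f x) (vel u x)) Ω volume) ∧
      (∀ u v : H10 Ω,
        IntegrableOn (phiVariation law μr τy u v) Ω volume ∧
        IntegrableOn (fun x => contraction (strain u x) (strain v x)) Ω volume ∧
        IntegrableOn (fun x => contraction (stress law m μr τy u x) (grad v x)) Ω volume) ∧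
      ConvexOn ℝ Set.univ (energy Ω law m μr τy f) ∧
      (∀ u : H10 Ω, ∃ L : H10 Ω →L[ℝ] ℝ, ∀ v : H10 Ω,
        HasLineDerivAt ℝ (energy Ω law m μr τy f) (L v) u v ∧
        L v = firstVariation Ω law m μr τy f u v ∧
        L v = weakResidual Ω law m μr τy f u v) ∧
      (∀ u : H10 Ω,
        (IsVelocitySolution Ω law m μr τy f u ↔
          IsCriticalPoint (energy Ω law m μr τy f) (solenoidal Ω) u) ∧
        (IsCriticalPoint (energy Ω law m μr τy f) (solenoidal Ω) u ↔
          u ∈ solenoidal Ω ∧ IsMinOn (energy Ω law m μr τy f) (solenoidal Ω) u)) ∧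
      (∀ (u : H10 Ω) (p : Vec d → ℝ),
        MemLp p 2 (volume.restrict (Ω : Set (Vec d))) →
        IsStokesPair Ω law m μr τy f u p →
        IsVelocitySolution Ω law m μr τy f u)) := by
  refine ⟨fun law r y hr hy => ⟨convexOn_phi law hr hy, contDiffOn_phi law hr hy,
    hasDerivWithinAt_phi law hr hy,
    fun m σ hm hσ => phiDeriv_div_add_eq_two_mul_viscosity law hm hr.le hy hσ⟩, ?_⟩
  intro d Ω law m μr τy f hm₀ hm h h0 hf
  have hconv := h.convexOn_energy law h0 hf hm₀
  have hderiv := h.hasLineDerivAt_energy (m := m) law h0 hf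
  have hweak := h.firstVariation_eq_weakResidual (f := f) law hm
  have hres : ∀ u v : H10 Ω, h.residual law m hf u v.1 = weakResidual Ω law m μr τy f u v :=
    fun u v => h.residual_apply law hm hf u v.1
  refine ⟨fun u => ⟨h.integrable_phi_strainII law h0 u, integrable_strainII_sq u,
      integrable_inner_vel hf u⟩,
    fun u v => ⟨h.integrable_phiVariation law u v, integrable_contraction_strain u v,
      h.integrable_contraction_stress law hm u v.1⟩,
    hconv,
    fun u => ⟨h.residual law m hf u ∘L (H10 Ω).subtypeL, fun v =>
      ⟨(hderiv u v).congr_deriv ((hweak u v).trans (hres u v).symm),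
        (hres u v).trans (hweak u v).symm, hres u v⟩⟩,
    fun u => ⟨(isCriticalPoint_iff_of_hasLineDerivAt fun v _ => hweak u v ▸ hderiv u v).symm,
      isCriticalPoint_iff_isMinOn (hconv.subset (Set.subset_univ _) (solenoidal Ω).convex)
        fun v _ => (hderiv u v).lineDifferentiableAt⟩,
    fun u p hp hup => hup.isVelocitySolution h hm hf hp⟩

theorem mainTheorem1 :
    -- `φ_i` and `φ_c` are convex `C¹` functions on `[0, ∞)` with the stated derivatives,
    -- and `φ'(σ) / (2 σ)` is twice the viscosity
    (∀ (law : Viscoplastic.Rheology) (r y : ℝ), 0 < r → 0 < y →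
      ConvexOn ℝ (Set.Ici 0) (fun σ => Viscoplastic.phi r y σ law) ∧
      ContDiffOn ℝ 1 (fun σ => Viscoplastic.phi r y σ law) (Set.Ici 0) ∧
      (∀ σ : ℝ, 0 ≤ σ → HasDerivWithinAt (fun s => Viscoplastic.phi r y s law)
        (Viscoplastic.phiDeriv r y σ law) (Set.Ici 0) σ) ∧
      (∀ m σ : ℝ, (law = Viscoplastic.Rheology.composite → m = 0) → 0 < σ →
        Viscoplastic.phiDeriv r y σ law / (2 * σ) + 2 * m =
          2 * Viscoplastic.viscosity m r y σ law)) ∧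
    -- the variational structure of the nonlinear Stokes problem
    (∀ (d : ℕ) (Ω : TopologicalSpace.Opens (Viscoplastic.Vec d))
      (law : Viscoplastic.Rheology) (m : ℝ) (μr τy : Viscoplastic.Vec d → ℝ)
      (f : Viscoplastic.Vec d → Viscoplastic.Vec d),
      IsConnected (Ω : Set (Viscoplastic.Vec d)) →
      0 ≤ m → (law = Viscoplastic.Rheology.composite → m = 0) →
      (∀ x ∈ Ω, 0 < μr x) → (∀ x ∈ Ω, 0 < τy x) →
      AEMeasurable μr (volume.restrict (Ω : Set (Viscoplastic.Vec d))) →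
      MemLp τy 2 (volume.restrict (Ω : Set (Viscoplastic.Vec d))) →
      IntegrableOn (fun x => Viscoplastic.phi (μr x) (τy x) 0 law) Ω volume →
      MemLp f 2 (volume.restrict (Ω : Set (Viscoplastic.Vec d))) →
      -- all the integrals converge
      (∀ u : Viscoplastic.H10 Ω,
        IntegrableOn (fun x =>
          Viscoplastic.phi (μr x) (τy x) (Viscoplastic.strainII u x) law) Ω volume ∧
        IntegrableOn (fun x => Viscoplastic.strainII u x ^ 2) Ω volume ∧
        IntegrableOn (fun x => inner ℝ (f x) (Viscoplastic.vel u x)) Ω volume) ∧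
      (∀ u v : Viscoplastic.H10 Ω,
        IntegrableOn (Viscoplastic.phiVariation law μr τy u v) Ω volume ∧
        IntegrableOn (fun x => Viscoplastic.contraction (Viscoplastic.strain u x)
          (Viscoplastic.strain v x)) Ω volume ∧
        IntegrableOn (fun x => Viscoplastic.contraction
          (Viscoplastic.stress law m μr τy u x) (Viscoplastic.grad v x)) Ω volume) ∧
      -- `Φ` is convex
      ConvexOn ℝ Set.univ (Viscoplastic.energy Ω law m μr τy f) ∧
      -- the Gateaux derivative of `Φ` is the weak form of the momentum equation
      (∀ u : Viscoplastic.H10 Ω, ∃ L : Viscoplastic.H10 Ω →L[ℝ] ℝ,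
        ∀ v : Viscoplastic.H10 Ω,
          HasLineDerivAt ℝ (Viscoplastic.energy Ω law m μr τy f) (L v) u v ∧
          L v = Viscoplastic.firstVariation Ω law m μr τy f u v ∧
          L v = Viscoplastic.weakResidual Ω law m μr τy f u v) ∧
      -- velocity solutions are the critical points, and these are the minimizers
      (∀ u : Viscoplastic.H10 Ω,
        (Viscoplastic.IsVelocitySolution Ω law m μr τy f u ↔
          Viscoplastic.IsCriticalPoint (Viscoplastic.energy Ω law m μr τy f)
            (Viscoplastic.solenoidal Ω) u) ∧
        (Viscoplastic.IsCriticalPoint (Viscoplastic.energy Ω law m μr τy f)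
            (Viscoplastic.solenoidal Ω) u ↔
          u ∈ Viscoplastic.solenoidal Ω ∧
            IsMinOn (Viscoplastic.energy Ω law m μr τy f) (Viscoplastic.solenoidal Ω) u)) ∧
      -- the velocity of every velocity-pressure solution is a velocity solution
      (∀ (u : Viscoplastic.H10 Ω) (p : Viscoplastic.Vec d → ℝ),
        MemLp p 2 (volume.restrict (Ω : Set (Viscoplastic.Vec d))) →
        Viscoplastic.IsStokesPair Ω law m μr τy f u p →
        Viscoplastic.IsVelocitySolution Ω law m μr τy f u)) := by
  refine ⟨mainTheorem1_general.1, fun d Ω law m μr τy f _ hm₀ hm hr hy hrmeas hyL2 =>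
    mainTheorem1_general.2 d Ω law m μr τy f hm₀ hm ⟨?_, ?_, hrmeas, hyL2⟩⟩
  exacts [ae_restrict_of_forall_mem Ω.isOpen.measurableSet hr,
    ae_restrict_of_forall_mem Ω.isOpen.measurableSet hy]
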